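/- Consider the p-system $v_t-u_x=0$, $u_t+p(v)_x=0$ with $p(v)=\frac1{3v^3}$, density $\rho=1/v$, and Riemann invariants $w_1=\rho-u$, $w_2=\rho+u$. Let $0<\alpha/3<\beta<\alpha<1$ and let $\kappa<3^{-2/3}$. Then there is $\delta_0>0$, depending only on $\alpha,\beta,\kappa$, such that the following holds for all $\delta\in\,]0,\delta_0[$, all $c>0$ and all $\xi\ge\delta$. Take initial data $(\rho,u)(0,\cdot)$ with $w_1(0,x)=0$ for all $x<\xi$ and $$w_2(0,x)=\begin{cases}0& x\le 0\\ x^\alpha\,(2+\sin x^{-\beta})& 0<x\le \delta\\ \delta^\alpha\,(2+\sin\delta^{-\beta})&\delta\le x<\xi\end{cases}$$ (so that $\rho=0$ for $x\le0$), with an admissible 1-shock at $x=\xi$ of unit strength, i.e. $|w_1(0,\xi+)-w_1(0,\xi-)|=1$, and with a constant state for $x>\xi$. Put $T=\xi/2c$ (so $T=\delta/2c$ if the shock starts at $\xi=\delta$). On $[0,T[$ consider approximate solutions $(\rho,u)$ with $\rho\ge0$ and these initial data, in which the 1-shock is located at $x=\xi-ct$, 1-waves travel with constant speed $-c$ and 2-waves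 with constant speed $c$ (on either side of the shock, $w_1$ is constant along lines $\dot x=-c$ and $w_2$ along lines $\dot x=c$), while outgoing strengths are exact: $(\rho,u)$ has limits $(\rho_\mp,u_\mp)(t)$ at $(t,\xi-ct)$ from the space-time regions $x<\xi-ct$ and $x>\xi-ct$, and these two states are joined by an admissible 1-shock of the p-system (the Rankine-Hugoniot equations and the Lax condition for the characteristic speed $-\rho^2$ hold for some shock speed, not necessarily $-c$). Such approximate solutions exist, and every one of them has the following properties. 1. For $0\le t<T$ one has $w_1(t,x)=0$ if $x<\xi-ct$, and $w_1(t,x)=1$ if $x>\xi-ct$; so the 1-shock keeps unit strength. 2. Each 2-wave that crosses the shock is amplified by a factor at least $\kappa\rho_-^{-2/3}$, where $\rho_-$ is the density ahead of the shock. Namely, for $0\le t<T$ and $y,z\in\,]\xi-2ct,\xi[$, $$|w_2(t,y+ct)-w_2(t,z+ct)|\ \ge\ \kappa\,\max\{\rho(0,y),\rho(0,z)\}^{-2/3}\,|w_2(0,y)-w_2(0,z)|,$$ and for $0\le t<T$ and $\xi-2ct<y<\delta$ the function $w_2(t,\cdot)$ is differentiable at $y+ct$, with $$|w_{2,x}(t,y+ct)|\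 \ge\ \kappa\,\rho(0,y)^{-2/3}\,\big|\alpha y^{\alpha-1}(2+\sin y^{-\beta})-\beta y^{\alpha-\beta-1}\cos y^{-\beta}\big|.$$ 3. The total variation $\mathrm{Tot.Var.}\{w_1(t,\cdot);\mathbb R\}+\mathrm{Tot.Var.}\{w_2(t,\cdot);\mathbb R\}$ is finite at $t=0$ and for every $t\in[0,T[$, and tends to $+\infty$ as $t\to T-$. -/

import Mathlib

open Set Filter Topology

namespace PSystem

/-- Pressure law of the p-system `v_t - u_x = 0`, `u_t + p(v)_x = 0` in Lagrangean
coordinates, as a function of the specific volume `v = 1 / ρ`. -/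
noncomputable def pressure (v : ℝ) : ℝ := 1 / (3 * v ^ 3)

/-- The first Riemann invariant `w₁ = ρ - u`. -/
def w₁ (ρ u : ℝ) : ℝ := ρ - u

/-- The second Riemann invariant `w₂ = ρ + u`. -/
def w₂ (ρ u : ℝ) : ℝ := ρ + u

/-- The left state `(ρL, uL)` and the right state `(ρR, uR)` are joined by an admissible 1-shock:
for some speed `lam`, the Rankine-Hugoniot equations of the p-system hold, together with the Lax
condition for the first characteristic speed `-ρ ^ 2`. -/
def IsOneShock (ρL uL ρR uR : ℝ) : Prop :=
  0 < ρL ∧ 0 < ρR ∧ ∃ lam : ℝ,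
    lam * (ρR⁻¹ - ρL⁻¹) = uL - uR ∧
    lam * (uR - uL) = pressure ρR⁻¹ - pressure ρL⁻¹ ∧
    -ρR ^ 2 < lam ∧ lam < -ρL ^ 2

/-- The profile of `w₂` ahead of the shock: `0` for `x ≤ 0`, `x ^ α * (2 + sin (x ^ (-β)))` for
`0 < x ≤ δ`, and constant for `x ≥ δ`, written through the truncation of `x` to `[0, δ]`. -/
noncomputable def profile (α β δ x : ℝ) : ℝ :=
  (max 0 (min x δ)) ^ α * (2 + Real.sin ((max 0 (min x δ)) ^ (-β)))

/-- The initial datum: `w₁ = 0` and `w₂ = profile` to the left of the point `ξ`, a 1-shock of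
strength one (the size of the jump in `w₁`) at `ξ`, and a constant state to the right of `ξ`. -/
def IsInitialDatum (α β δ ξ : ℝ) (ρ₀ u₀ : ℝ → ℝ) : Prop :=
  (∀ x, x < ξ → w₁ (ρ₀ x) (u₀ x) = 0 ∧ w₂ (ρ₀ x) (u₀ x) = profile α β δ x) ∧
  ∃ ρL uL ρR uR : ℝ,
    w₁ ρL uL = 0 ∧ w₂ ρL uL = profile α β δ ξ ∧
    IsOneShock ρL uL ρR uR ∧ |w₁ ρR uR - w₁ ρL uL| = 1 ∧
    ∀ x, ξ < x → ρ₀ x = ρR ∧ u₀ x = uR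

/-- The space-time region, up to time `T`, to the left of the line `x = ξ - c * t`. -/
def leftRegion (c ξ T : ℝ) : Set (ℝ × ℝ) := {z | 0 ≤ z.1 ∧ z.1 < T ∧ z.2 < ξ - c * z.1}

/-- The space-time region, up to time `T`, to the right of the line `x = ξ - c * t`. -/
def rightRegion (c ξ T : ℝ) : Set (ℝ × ℝ) := {z | 0 ≤ z.1 ∧ z.1 < T ∧ ξ - c * z.1 < z.2}

/-- `(ρ, u)` is, on the time interval `[0, T)`, an approximate solution of the p-system with one
1-shock, issued from `ξ`, all of whose waves travel with speed `-c` (the 1-waves, among them the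
shock) or `c` (the 2-waves), while the strengths of the waves that leave the shock are exact.
Off the shock, a change in `w₁` is a 1-wave and a change in `w₂` is a 2-wave, so `w₁` is constant
along segments of speed `-c`, and `w₂` along segments of speed `c`, which stay on one side of the
shock. At each time the traces on the two sides of the shock are joined by an exact 1-shock of the
p-system. -/
structure IsApproxSolution (c ξ T : ℝ) (ρ u : ℝ → ℝ → ℝ) : Prop where
  density_nonneg : ∀ t x, 0 ≤ t → t < T → 0 ≤ ρ t x
  one_waves : ∀ s t y, 0 ≤ s → s ≤ t → t < T → y ≠ ξ - c * s →
    w₁ (ρ t (y - c * (t - s))) (u t (y - c * (t - s))) = w₁ (ρ s y) (u s y)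
  two_waves : ∀ s t y, 0 ≤ s → s ≤ t → t < T →
    (y + c * (t - s) < ξ - c * t ∨ ξ - c * s < y) →
    w₂ (ρ t (y + c * (t - s))) (u t (y + c * (t - s))) = w₂ (ρ s y) (u s y)
  shock : ∀ t, 0 ≤ t → t < T → ∃ ρL uL ρR uR : ℝ,
    Tendsto (fun z : ℝ × ℝ => (ρ z.1 z.2, u z.1 z.2))
      (𝓝[leftRegion c ξ T] (t, ξ - c * t)) (𝓝 (ρL, uL)) ∧
    Tendsto (fun z : ℝ × ℝ => (ρ z.1 z.2, u z.1 z.2))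
      (𝓝[rightRegion c ξ T] (t, ξ - c * t)) (𝓝 (ρR, uR)) ∧
    IsOneShock ρL uL ρR uR

/-- Total variation on the real line of a state, measured by the Riemann invariants. -/
noncomputable def totalVariation (ρ₀ u₀ : ℝ → ℝ) : ENNReal :=
  eVariationOn (fun x => w₁ (ρ₀ x) (u₀ x)) univ + eVariationOn (fun x => w₂ (ρ₀ x) (u₀ x)) univ

end PSystem

/-!
Across a 1-shock of unit strength the density jumps from `a` to `a + s`, where the Rankine-Hugoniot
equations reduce to `s ^ 4 = 3 * a * (a + s) * (1 - 2 * s)`. Near the vacuum `s ^ 3` is therefore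
about `3 * a`, so that `s` has slope about `(3 * a) ^ (-2 / 3)` as a function of `a`: a 2-wave which
crosses the shock is amplified by a factor of this order. Between consecutive extrema at `x` of the
sine, `w₂` oscillates initially by about `x ^ α`, at a density of the same order, hence by about
`x ^ (α / 3)` once the wave has crossed the shock. The extrema are `x ≈ (k * π) ^ (-1 / β)`, and the
sum over `k` of `x ^ (α / 3)` diverges as soon as `α / 3 ≤ β`, whereas that of `x ^ α` converges for
`β < α`. At time `ξ / (2 * c)` the shock has met all of these oscillations.
-/

namespace PSystem

/-! ### Functions of bounded variation -/

section BoundedVariation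

variable {ι E : Type*} [LinearOrder ι]

theorem eVariationOn_le_of_edist_le [PseudoEMetricSpace E] {F : Type*} [PseudoEMetricSpace F]
    {f : ι → E} {g : ι → F} {s : Set ι}
    (h : ∀ x ∈ s, ∀ y ∈ s, edist (f x) (f y) ≤ edist (g x) (g y)) :
    eVariationOn f s ≤ eVariationOn g s :=
  iSup_mono fun p => Finset.sum_le_sum fun _ _ => h _ (p.2.2.2 _) _ (p.2.2.2 _)

theorem boundedVariationOn_of_forall_eq [PseudoEMetricSpace E] {f : ι → E} {s : Set ι} {b : E}
    (h : ∀ ⦃x⦄, x ∈ s → f x = b) : BoundedVariationOn f s := by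
  rw [BoundedVariationOn, eVariationOn.constant_on]
  · exact ENNReal.zero_ne_top
  · rintro _ ⟨x, hx, rfl⟩ _ ⟨y, hy, rfl⟩
    rw [h hx, h hy]

theorem sum_edist_le_eVariationOn_of_antitone [PseudoEMetricSpace E] (f : ι → E) {s : Set ι}
    {u : ℕ → ι} (hu : Antitone u) (hus : ∀ i, u i ∈ s) (n : ℕ) :
    ∑ i ∈ Finset.range n, edist (f (u (i + 1))) (f (u i)) ≤ eVariationOn f s :=
  calc ∑ i ∈ Finset.range n, edist (f (u (i + 1))) (f (u i))
      ≤ eVariationOn (f ∘ u) univ := eVariationOn.sum_le monotone_id fun _ => mem_univ _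
    _ ≤ eVariationOn f s :=
      eVariationOn.comp_le_of_antitoneOn f u (hu.antitoneOn _) fun i _ => hus i

theorem sum_edist_even_odd_le_eVariationOn [PseudoEMetricSpace E] (f : ι → E) {s : Set ι}
    {u : ℕ → ι} (hu : Antitone u) (hus : ∀ i, u i ∈ s) (n : ℕ) :
    ∑ i ∈ Finset.range n, edist (f (u (2 * i + 1))) (f (u (2 * i))) ≤ eVariationOn f s := by
  refine le_trans ?_ (sum_edist_le_eVariationOn_of_antitone f hu hus (2 * n))
  induction n with
  | zero => simp
  | succ n ih =>
    rw [mul_add_one, Finset.sum_range_succ, Finset.sum_range_succ, Finset.sum_range_succ]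
    exact le_add_right (add_le_add_left ih _)

variable [TopologicalSpace ι] [OrderTopology ι]

theorem boundedVariationOn_univ_of_Iio_of_Ioi [DenselyOrdered ι] [NoMinOrder ι] [NoMaxOrder ι]
    [PseudoMetricSpace E] [CompleteSpace E] {f : ι → E} {p : ι}
    (hl : BoundedVariationOn f (Iio p)) (hr : BoundedVariationOn f (Ioi p)) :
    BoundedVariationOn f univ := by
  obtain ⟨l, hl'⟩ := hl.exists_tendsto_left p
  obtain ⟨r, hr'⟩ := hr.exists_tendsto_right p
  rw [inter_self] at hl' hr'
  have left := eVariationOn.eVariationOn_on_inter_Iic_eq_Iio_add_edist (s := univ)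
    (by rw [univ_inter]; infer_instance) (mem_univ p) (by rwa [univ_inter])
  have right := eVariationOn.eVariationOn_on_inter_Ici_eq_Ioi_add_edist (s := univ)
    (by rw [univ_inter]; infer_instance) (mem_univ p) (by rwa [univ_inter])
  simp only [univ_inter] at left right
  rw [BoundedVariationOn, ← Iic_union_Ici (a := p), eVariationOn.union f isGreatest_Iic isLeast_Ici,
    left, right]
  exact ENNReal.add_ne_top.2 ⟨ENNReal.add_ne_top.2 ⟨hl, edist_ne_top _ _⟩,
    ENNReal.add_ne_top.2 ⟨hr, edist_ne_top _ _⟩⟩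

theorem tendsto_eVariationOn_Ioi [PseudoEMetricSpace E] (f : ι → E) (a : ι) :
    Tendsto (fun q => eVariationOn f (Ioi q)) (𝓝[>] a) (𝓝 (eVariationOn f (Ioi a))) := by
  refine tendsto_order.2 ⟨fun l hl => ?_, fun r hr => ?_⟩
  · obtain ⟨x, hx, y, -, -, hxy⟩ := eVariationOn.exists_lt_eVariationOn_inter_Icc hl
    filter_upwards [Ioo_mem_nhdsGT hx] with q hq
    exact hxy.trans_le (eVariationOn.mono f fun z hz => hq.2.trans_le hz.2.1)
  · filter_upwards [self_mem_nhdsWithin] with q hq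
    exact (eVariationOn.mono f (Ioi_subset_Ioi (le_of_lt hq))).trans_lt hr

end BoundedVariation

/-! ### Shocks of unit strength -/

theorem isOneShock_iff {ρL uL ρR uR : ℝ} :
    IsOneShock ρL uL ρR uR ↔ 0 < ρL ∧ ρL < ρR ∧ uR < uL ∧
      3 * ρL * ρR * (uL - uR) ^ 2 = (ρR - ρL) * (ρR ^ 3 - ρL ^ 3) := by
  constructor
  · rintro ⟨hL, hR, lam, mass, momentum, lax_right, lax_left⟩
    have hρ : ρL < ρR := lt_of_pow_lt_pow_left₀ 2 hR.le (by linarith)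
    have : lam < 0 := by nlinarith
    have mass' : (uL - uR) * (ρL * ρR) = -lam * (ρR - ρL) := by
      rw [← mass]; field_simp; ring
    have momentum' : -lam * (uL - uR) * 3 = ρR ^ 3 - ρL ^ 3 := by
      rw [neg_mul_comm, neg_sub, momentum]; unfold pressure; field_simp
    have hu : 0 < (uL - uR) * (ρL * ρR) := by rw [mass']; nlinarith
    refine ⟨hL, hρ, sub_pos.1 (pos_of_mul_pos_left hu (by positivity)), ?_⟩
    linear_combination 3 * (uL - uR) * mass' + (ρR - ρL) * momentum'
  · rintro ⟨hL, hρ, hu, h⟩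
    have hR := hL.trans hρ
    have hd : 0 < ρR - ρL := sub_pos.2 hρ
    have hv : 0 < uL - uR := sub_pos.2 hu
    set speed := (uL - uR) * ρL * ρR / (ρR - ρL) with hspeed
    have speed_pos : 0 < speed := by positivity
    have speed_sq : 3 * speed ^ 2 = ρL * ρR * (ρR ^ 2 + ρR * ρL + ρL ^ 2) := by
      rw [hspeed, div_pow, mul_div_assoc', div_eq_iff (by positivity)]
      linear_combination ρL * ρR * h
    refine ⟨hL, hR, -speed, ?_, ?_, neg_lt_neg ?_, neg_lt_neg ?_⟩
    · rw [hspeed]; field_simp; ring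
    · rw [hspeed]; unfold pressure; field_simp; linear_combination h
    · refine lt_of_pow_lt_pow_left₀ 2 (by positivity) ?_
      nlinarith [mul_pos hL hR, mul_pos hd hR, mul_pos (mul_pos hL hR) (mul_pos hd hR),
        mul_pos (mul_pos hR hR) (mul_pos hd hR), mul_pos (mul_pos hL hL) (mul_pos hd hR)]
    · refine lt_of_pow_lt_pow_left₀ 2 speed_pos.le ?_
      nlinarith [mul_pos hL hR, mul_pos hd hL, mul_pos (mul_pos hL hR) (mul_pos hd hL),
        mul_pos (mul_pos hR hR) (mul_pos hd hL), mul_pos (mul_pos hL hL) (mul_pos hd hL)]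

theorem IsOneShock.w₁_lt {ρL uL ρR uR : ℝ} (h : IsOneShock ρL uL ρR uR) :
    w₁ ρL uL < w₁ ρR uR := by
  obtain ⟨-, hρ, hu, -⟩ := isOneShock_iff.1 h
  exact sub_lt_sub hρ hu

/-- Some 1-shock of unit strength has density `a` ahead and `a + s` behind. Across such a shock the
velocity drops by `1 - s`, and the last equation is what remains of the Rankine-Hugoniot equations
once the speed is eliminated. -/
structure IsUnitJump (a s : ℝ) : Prop where
  density_pos : 0 < a
  pos : 0 < s
  lt_half : s < 1 / 2
  hugoniot : s ^ 4 = 3 * a * (a + s) * (1 - 2 * s)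

theorem isOneShock_iff_isUnitJump {ρL uL ρR uR : ℝ} (h : w₁ ρR uR - w₁ ρL uL = 1) :
    IsOneShock ρL uL ρR uR ↔ IsUnitJump ρL (ρR - ρL) := by
  obtain ⟨s, rfl⟩ : ∃ s, ρR = ρL + s := ⟨ρR - ρL, by ring⟩
  obtain rfl : uR = uL - (1 - s) := by unfold w₁ at h; linarith
  rw [isOneShock_iff, add_sub_cancel_left, sub_sub_cancel]
  constructor
  · rintro ⟨ha, hs, -, e⟩
    have hs : 0 < s := by linarith
    have hug : s ^ 4 = 3 * ρL * (ρL + s) * (1 - 2 * s) := by linear_combination -e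
    have h4 : 0 < 3 * ρL * (ρL + s) * (1 - 2 * s) := hug ▸ by positivity
    have := pos_of_mul_pos_right h4 (by positivity)
    exact ⟨ha, hs, by linarith, hug⟩
  · rintro ⟨ha, hs, hs', hug⟩
    exact ⟨ha, by linarith, by linarith, by linear_combination -hug⟩

theorem IsUnitJump.one_sub_two_mul_pos {a s : ℝ} (h : IsUnitJump a s) : 0 < 1 - 2 * s := by
  linarith [h.lt_half]

theorem exists_isUnitJump {a : ℝ} (ha : 0 < a) : ∃ s, IsUnitJump a s := by
  have hc : ContinuousOn (fun s : ℝ => s ^ 4 - 3 * a * (a + s) * (1 - 2 * s)) (Icc 0 (1 / 2)) := by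
    fun_prop
  obtain ⟨s, hs, hs'⟩ := intermediate_value_Ioo (by norm_num) hc
    (show (0 : ℝ) ∈ Ioo _ _ from ⟨by nlinarith [mul_pos ha ha], by norm_num⟩)
  exact ⟨s, ha, hs.1, hs.2, sub_eq_zero.1 hs'⟩

/-- The density ahead of a 1-shock of unit strength, as a function of the jump `s` of the density:
the positive root of the quadratic equation for `a` in `IsUnitJump a s`. -/
noncomputable def jumpInv (s : ℝ) : ℝ := (√(s ^ 2 + 4 * s ^ 4 / (3 * (1 - 2 * s))) - s) / 2

theorem isUnitJump_jumpInv {s : ℝ} (hs : s ∈ Ioo 0 (1 / 2)) : IsUnitJump (jumpInv s) s := by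
  obtain ⟨hs, hs'⟩ := hs
  have p : 0 < 1 - 2 * s := by linarith
  set r := 4 * s ^ 4 / (3 * (1 - 2 * s)) with hr
  have hr0 : 0 < r := by positivity
  have hsq : √(s ^ 2 + r) ^ 2 = s ^ 2 + r := Real.sq_sqrt (by positivity)
  have hlt : s < √(s ^ 2 + r) := Real.lt_sqrt_of_sq_lt (by linarith)
  refine ⟨by unfold jumpInv; linarith, hs, hs', ?_⟩
  have h4 : r * (3 * (1 - 2 * s)) = 4 * s ^ 4 := div_mul_cancel₀ _ (by positivity)
  unfold jumpInv
  rw [← hr]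
  linear_combination -3 / 4 * (1 - 2 * s) * hsq - h4 / 4

theorem IsUnitJump.jumpInv_eq {a s : ℝ} (h : IsUnitJump a s) : jumpInv s = a := by
  have h' := isUnitJump_jumpInv ⟨h.pos, h.lt_half⟩
  have hfac : (jumpInv s - a) * ((jumpInv s + a + s) * (1 - 2 * s)) = 0 := by
    linarith [h.hugoniot, h'.hugoniot]
  have := h.density_pos
  have := h'.density_pos
  have := h.pos
  have := h.one_sub_two_mul_pos
  exact sub_eq_zero.1 ((mul_eq_zero.1 hfac).resolve_right (by positivity))

/-- The derivative at `a` of the density jump `s` across 1-shocks of unit strength, as obtained by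
differentiating `IsUnitJump.hugoniot` implicitly. -/
noncomputable def jumpSlope (a s : ℝ) : ℝ :=
  s * (2 * a + s) * (1 - 2 * s) / (a * ((4 * a + 3 * s) * (1 - 2 * s) + 2 * s * (a + s)))

theorem IsUnitJump.jumpSlope_pos {a s : ℝ} (h : IsUnitJump a s) : 0 < jumpSlope a s := by
  have := h.density_pos
  have := h.pos
  have := h.one_sub_two_mul_pos
  unfold jumpSlope
  positivity

theorem IsUnitJump.jumpSlope_le {a s : ℝ} (h : IsUnitJump a s) : jumpSlope a s ≤ 1 / a := by
  have ha := h.density_pos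
  have hs := h.pos
  have p := h.one_sub_two_mul_pos
  unfold jumpSlope
  rw [div_le_div_iff₀ (by positivity) ha, one_mul, mul_comm]
  gcongr
  nlinarith [mul_pos ha p, mul_pos hs p, mul_pos hs ha, h.lt_half, mul_pos (mul_pos hs p) ha]

theorem hasDerivAt_jumpInv {s : ℝ} (hs : s ∈ Ioo 0 (1 / 2)) :
    HasDerivAt jumpInv (jumpSlope (jumpInv s) s)⁻¹ s := by
  have h := isUnitJump_jumpInv hs
  have hs0 := h.pos
  have p := h.one_sub_two_mul_pos
  obtain ⟨d, hd⟩ : ∃ d, HasDerivAt jumpInv d s := by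
    have h1 : DifferentiableAt ℝ (fun s : ℝ => s ^ 2 + 4 * s ^ 4 / (3 * (1 - 2 * s))) s := by
      fun_prop (disch := positivity)
    exact ⟨_, (((h1.sqrt (by positivity)).sub differentiableAt_id).div_const 2).hasDerivAt⟩
  have h_right : HasDerivAt (fun s => 3 * jumpInv s * (jumpInv s + s) * (1 - 2 * s))
      ((3 * d * (jumpInv s + s) + 3 * jumpInv s * (d + 1)) * (1 - 2 * s) +
        3 * jumpInv s * (jumpInv s + s) * (-2)) s := by
    refine ((hd.const_mul 3).mul (hd.add (hasDerivAt_id s))).mul ?_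
    simpa using ((hasDerivAt_id s).const_mul 2).const_sub 1
  have h_left : HasDerivAt (fun s : ℝ => s ^ 4) (4 * s ^ 3) s := by
    simpa using hasDerivAt_pow 4 s
  have h_eq : (fun s => 3 * jumpInv s * (jumpInv s + s) * (1 - 2 * s)) =ᶠ[𝓝 s] fun s => s ^ 4 := by
    filter_upwards [isOpen_Ioo.mem_nhds hs] with x hx using (isUnitJump_jumpInv hx).hugoniot.symm
  have implicit := h_right.unique (h_left.congr_of_eventuallyEq h_eq)
  have ha := h.density_pos
  have hug := h.hugoniot
  generalize jumpInv s = a at *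
  convert hd using 1
  unfold jumpSlope
  rw [inv_div, div_eq_iff (by positivity)]
  linear_combination -(s / 3) * implicit - 4 / 3 * hug

theorem strictMonoOn_jumpInv : StrictMonoOn jumpInv (Ioo 0 (1 / 2)) := by
  refine strictMonoOn_of_deriv_pos (convex_Ioo _ _)
    (fun s hs => (hasDerivAt_jumpInv hs).continuousAt.continuousWithinAt) fun s hs => ?_
  rw [interior_Ioo] at hs
  rw [(hasDerivAt_jumpInv hs).deriv]
  exact inv_pos.2 (isUnitJump_jumpInv hs).jumpSlope_pos

/-- The jump of the density across the 1-shock of unit strength with density `a > 0` ahead of it;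
the value for `a ≤ 0` is irrelevant. -/
noncomputable def jump (a : ℝ) : ℝ := Function.invFunOn jumpInv (Ioo 0 (1 / 2)) a

theorem isUnitJump_jump {a : ℝ} (ha : 0 < a) : IsUnitJump a (jump a) := by
  obtain ⟨s, hs⟩ := exists_isUnitJump ha
  have h : ∃ s ∈ Ioo 0 (1 / 2), jumpInv s = a := ⟨s, ⟨hs.pos, hs.lt_half⟩, hs.jumpInv_eq⟩
  simpa only [jump, Function.invFunOn_eq h] using
    isUnitJump_jumpInv (Function.invFunOn_mem h)

theorem IsUnitJump.jump_eq {a s : ℝ} (h : IsUnitJump a s) : jump a = s :=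
  have h' := isUnitJump_jump h.density_pos
  strictMonoOn_jumpInv.injOn ⟨h'.pos, h'.lt_half⟩ ⟨h.pos, h.lt_half⟩
    (h'.jumpInv_eq.trans h.jumpInv_eq.symm)

theorem strictMonoOn_jump : StrictMonoOn jump (Ioi 0) := by
  intro a ha b hb hab
  have hja := isUnitJump_jump ha
  have hjb := isUnitJump_jump hb
  rwa [← strictMonoOn_jumpInv.lt_iff_lt ⟨hja.pos, hja.lt_half⟩ ⟨hjb.pos, hjb.lt_half⟩,
    hja.jumpInv_eq, hjb.jumpInv_eq]

theorem continuousAt_jump {a : ℝ} (ha : 0 < a) : ContinuousAt jump a := by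
  have h := isUnitJump_jump ha
  refine strictMonoOn_jump.continuousAt_of_image_mem_nhds (Ioi_mem_nhds ha)
    (mem_of_superset (Ioo_mem_nhds h.pos h.lt_half) fun s hs => ?_)
  have hs := isUnitJump_jumpInv hs
  exact ⟨jumpInv s, hs.density_pos, hs.jump_eq⟩

theorem hasDerivAt_jump {a : ℝ} (ha : 0 < a) : HasDerivAt jump (jumpSlope a (jump a)) a := by
  have h := isUnitJump_jump ha
  have hinv := hasDerivAt_jumpInv ⟨h.pos, h.lt_half⟩
  rw [h.jumpInv_eq] at hinv
  simpa only [inv_inv] using HasDerivAt.of_local_left_inverse (continuousAt_jump ha) hinv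
    (inv_ne_zero h.jumpSlope_pos.ne')
    (by filter_upwards [Ioi_mem_nhds ha] with y hy using (isUnitJump_jump hy).jumpInv_eq)

theorem tendsto_jump_zero : Tendsto jump (𝓝[>] 0) (𝓝 0) := by
  refine tendsto_order.2 ⟨fun l hl => ?_, fun r hr => ?_⟩
  · filter_upwards [self_mem_nhdsWithin] with a ha using hl.trans (isUnitJump_jump ha).pos
  · have hs : min r (1 / 4) ∈ Ioo (0 : ℝ) (1 / 2) :=
      ⟨by positivity, (min_le_right _ _).trans_lt (by norm_num)⟩
    have h := isUnitJump_jumpInv hs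
    filter_upwards [Ioo_mem_nhdsGT h.density_pos] with a ha
    calc jump a < jump (jumpInv (min r (1 / 4))) := strictMonoOn_jump ha.1 h.density_pos ha.2
      _ = min r (1 / 4) := h.jump_eq
      _ ≤ r := min_le_left _ _

theorem tendsto_div_jump_zero : Tendsto (fun a => a / jump a) (𝓝[>] 0) (𝓝 0) := by
  have upper : Tendsto (fun a => jump a ^ 2 / (3 * (1 - 2 * jump a))) (𝓝[>] 0) (𝓝 0) := by
    simpa [Pi.div_def] using (tendsto_jump_zero.pow 2).div
      (((tendsto_jump_zero.const_mul 2).const_sub 1).const_mul 3) (by norm_num)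
  refine tendsto_of_tendsto_of_tendsto_of_le_of_le' tendsto_const_nhds upper ?_ ?_ <;>
    filter_upwards [self_mem_nhdsWithin] with a (ha : 0 < a)
  all_goals
    have h := isUnitJump_jump ha
    have hs := h.pos
    have p := h.one_sub_two_mul_pos
  · positivity
  · rw [div_le_div_iff₀ hs (by positivity)]
    refine le_of_mul_le_mul_right ?_ hs
    nlinarith [h.hugoniot, mul_pos (mul_pos ha ha) p]

theorem tendsto_jump_pow_three_div : Tendsto (fun a => jump a ^ 3 / a) (𝓝[>] 0) (𝓝 3) := by
  have : Tendsto (fun a => 3 * (1 + a / jump a) * (1 - 2 * jump a)) (𝓝[>] 0) (𝓝 3) := by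
    simpa using ((tendsto_div_jump_zero.const_add 1).const_mul 3).mul
      ((tendsto_jump_zero.const_mul 2).const_sub 1)
  refine this.congr' ?_
  filter_upwards [self_mem_nhdsWithin] with a (ha : 0 < a)
  have h := isUnitJump_jump ha
  have hs := h.pos
  field_simp
  linear_combination -h.hugoniot

theorem tendsto_jumpSlope_mul_rpow :
    Tendsto (fun a => jumpSlope a (jump a) * a ^ (2 / 3 : ℝ)) (𝓝[>] 0)
      (𝓝 (3 ^ (-(2 / 3) : ℝ))) := by
  have hs := (tendsto_jump_zero.const_mul 2).const_sub 1
  have hq := tendsto_div_jump_zero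
  have ratio : Tendsto (fun a => (2 * (a / jump a) + 1) * (1 - 2 * jump a) /
      ((4 * (a / jump a) + 3) * (1 - 2 * jump a) + 2 * jump a * (a / jump a + 1)))
      (𝓝[>] 0) (𝓝 (1 / 3)) := by
    simpa [Pi.div_def] using (((hq.const_mul 2).add_const 1).mul hs).div
      ((((hq.const_mul 4).add_const 3).mul hs).add
        ((tendsto_jump_zero.const_mul 2).mul (hq.add_const 1))) (by norm_num)
  have root := tendsto_jump_pow_three_div.rpow_const (p := 1 / 3) (by norm_num)
  have hlim : (3 : ℝ) ^ (1 / 3 : ℝ) * (1 / 3) = 3 ^ (-(2 / 3) : ℝ) := by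
    rw [show (-(2 / 3) : ℝ) = 1 / 3 - 1 by norm_num, Real.rpow_sub_one (by norm_num), mul_one_div]
  rw [← hlim]
  refine (root.mul ratio).congr' ?_
  filter_upwards [self_mem_nhdsWithin] with a (ha : 0 < a)
  have h := isUnitJump_jump ha
  have hs := h.pos
  have := h.one_sub_two_mul_pos
  have ha3 : a ^ (2 / 3 : ℝ) * a ^ (1 / 3 : ℝ) = a := by
    rw [← Real.rpow_add ha]; norm_num
  have hs3 : (jump a ^ 3) ^ (1 / 3 : ℝ) = jump a := by
    rw [← Real.rpow_natCast, ← Real.rpow_mul hs.le]; norm_num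
  rw [Real.div_rpow (by positivity) ha.le, hs3]
  unfold jumpSlope
  have : 0 < a ^ (1 / 3 : ℝ) := by positivity
  rw [← eq_div_iff this.ne'] at ha3
  rw [ha3]
  field_simp

theorem exists_le_jumpSlope {κ : ℝ} (hκ : κ < 3 ^ (-(2 / 3) : ℝ)) :
    ∃ a₀ > 0, ∀ a ∈ Ioo 0 a₀, κ * a ^ (-(2 / 3) : ℝ) ≤ jumpSlope a (jump a) := by
  obtain ⟨a₀, ha₀, h⟩ := mem_nhdsGT_iff_exists_Ioo_subset.1
    (tendsto_jumpSlope_mul_rpow.eventually_const_lt hκ)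
  refine ⟨a₀, ha₀, fun a ha => ?_⟩
  have := ha.1
  rw [Real.rpow_neg ha.1.le, ← div_eq_mul_inv, div_le_iff₀ (by positivity)]
  exact (h ha).le

/-- The value of `w₂` behind the 1-shock of unit strength which has density `a` and `w₁ = 0` ahead
of it. -/
noncomputable def behind (a : ℝ) : ℝ := 2 * (a + jump a) - 1

theorem IsOneShock.w₁_eq_one {ρL uL ρR uR : ℝ} (h : IsOneShock ρL uL ρR uR) (hL : w₁ ρL uL = 0)
    (hR : |w₁ ρR uR - w₁ ρL uL| = 1) : w₁ ρR uR = 1 := by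
  rwa [abs_of_pos (sub_pos.2 h.w₁_lt), hL, sub_zero] at hR

theorem IsOneShock.w₂_eq_behind {ρL uL ρR uR : ℝ} (h : IsOneShock ρL uL ρR uR)
    (hL : w₁ ρL uL = 0) (hR : w₁ ρR uR = 1) : w₂ ρR uR = behind (w₂ ρL uL / 2) := by
  have hjump := ((isOneShock_iff_isUnitJump (by rw [hL, hR, sub_zero])).1 h).jump_eq
  unfold w₁ at hL hR
  have hρ : w₂ ρL uL / 2 = ρL := by unfold w₂; linarith
  rw [hρ, behind, hjump, w₂]
  linarith

theorem isOneShock_behind {a : ℝ} (ha : 0 < a) :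
    IsOneShock a a (a + jump a) (a + jump a - 1) := by
  rw [isOneShock_iff_isUnitJump (by unfold w₁; ring), add_sub_cancel_left]
  exact isUnitJump_jump ha

theorem hasDerivAt_behind {a : ℝ} (ha : 0 < a) :
    HasDerivAt behind (2 * (1 + jumpSlope a (jump a))) a :=
  (((hasDerivAt_id a).add (hasDerivAt_jump ha)).const_mul 2).sub_const 1

theorem exists_lipschitzOnWith_behind {m : ℝ} (hm : 0 < m) :
    ∃ C, LipschitzOnWith C behind (Ici m) := by
  refine ⟨(2 * (1 + 1 / m)).toNNReal,
    (convex_Ici m).lipschitzOnWith_of_nnnorm_hasDerivWithin_le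
      (fun a ha => (hasDerivAt_behind (hm.trans_le ha)).hasDerivWithinAt) fun a ha => ?_⟩
  have h := isUnitJump_jump (hm.trans_le ha)
  have hslope := h.jumpSlope_pos
  rw [Real.le_toNNReal_iff_coe_le (by positivity), coe_nnnorm, Real.norm_of_nonneg (by positivity)]
  gcongr
  exact h.jumpSlope_le.trans (one_div_le_one_div_of_le hm ha)

theorem le_abs_behind_sub {κ a₀ : ℝ}
    (h₀ : ∀ a ∈ Ioo 0 a₀, κ * a ^ (-(2 / 3) : ℝ) ≤ jumpSlope a (jump a)) {a b : ℝ}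
    (ha : a ∈ Ioo 0 a₀) (hb : b ∈ Ioo 0 a₀) :
    κ * max a b ^ (-(2 / 3) : ℝ) * |2 * a - 2 * b| ≤ |behind a - behind b| := by
  wlog hab : a ≤ b generalizing a b
  · rw [max_comm, abs_sub_comm, abs_sub_comm (behind a)]
    exact this hb ha (le_of_not_ge hab)
  rcases le_or_gt κ 0 with hκ | hκ
  · exact (mul_nonpos_of_nonpos_of_nonneg (mul_nonpos_of_nonpos_of_nonneg hκ
      (Real.rpow_nonneg (ha.1.le.trans (le_max_left _ _)) _)) (abs_nonneg _)).trans (abs_nonneg _)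
  have hpos : ∀ x ∈ Icc a b, 0 < x := fun x hx => ha.1.trans_le hx.1
  have mean_value := (convex_Icc a b).mul_sub_le_image_sub_of_le_deriv (f := behind)
    (C := 2 * (κ * b ^ (-(2 / 3) : ℝ)))
    (fun x hx => (hasDerivAt_behind (hpos x hx)).continuousAt.continuousWithinAt)
    (fun x hx =>
      (hasDerivAt_behind (hpos x (interior_subset hx))).differentiableAt.differentiableWithinAt)
    (fun x hx => ?_) a (left_mem_Icc.2 hab) b (right_mem_Icc.2 hab) hab
  · rw [max_eq_right hab, abs_sub_comm, abs_sub_comm (behind a),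
      abs_of_nonneg (by linarith : 0 ≤ 2 * b - 2 * a)]
    refine le_trans ?_ (le_abs_self _)
    linarith
  · have hx := interior_subset hx
    rw [(hasDerivAt_behind (hpos x hx)).deriv]
    have hslope := h₀ x ⟨hpos x hx, hx.2.trans_lt hb.2⟩
    have hanti := mul_le_mul_of_nonneg_left (Real.rpow_le_rpow_of_nonpos (hpos x hx) hx.2
      (by norm_num : (-(2 / 3) : ℝ) ≤ 0)) hκ.le
    linarith

/-! ### The oscillating profile -/

/-- The profile of `w₂` before it is truncated at `δ`. -/
noncomputable def wave (α β x : ℝ) : ℝ := x ^ α * (2 + Real.sin (x ^ (-β)))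

/-- A monotone function whose increments bound those of `wave`: its derivative bounds the
derivative of `wave`. -/
noncomputable def waveBound (α β x : ℝ) : ℝ := 3 * x ^ α + β / (α - β) * x ^ (α - β)

section Profile

variable {α β δ x y : ℝ}

theorem profile_eq_wave (α β δ x : ℝ) : profile α β δ x = wave α β (max 0 (min x δ)) := rfl

theorem profile_of_mem (hx : x ∈ Icc 0 δ) : profile α β δ x = wave α β x := by
  rw [profile_eq_wave, min_eq_left hx.2, max_eq_right hx.1]

theorem rpow_le_wave (hx : 0 ≤ x) : x ^ α ≤ wave α β x :=
  le_mul_of_one_le_right (by positivity) (by linarith [Real.neg_one_le_sin (x ^ (-β))])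

theorem wave_le (hx : 0 ≤ x) : wave α β x ≤ 3 * x ^ α := by
  rw [wave, mul_comm 3]
  gcongr
  linarith [Real.sin_le_one (x ^ (-β))]

theorem profile_nonneg (α β δ x : ℝ) : 0 ≤ profile α β δ x :=
  (Real.rpow_nonneg (le_max_left _ _) _).trans (rpow_le_wave (le_max_left _ _))

theorem rpow_le_profile (hα : 0 ≤ α) (hx : 0 ≤ x) (hxδ : x ≤ δ) (hxy : x ≤ y) :
    x ^ α ≤ profile α β δ y :=
  (Real.rpow_le_rpow hx ((le_min hxy hxδ).trans (le_max_right _ _)) hα).trans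
    (rpow_le_wave (le_max_left _ _))

theorem profile_pos (hα : 0 ≤ α) (hδ : 0 < δ) (hx : 0 < x) : 0 < profile α β δ x :=
  (Real.rpow_pos_of_pos (lt_min hx hδ) α).trans_le
    (rpow_le_profile hα (lt_min hx hδ).le (min_le_right _ _) (min_le_left _ _))

theorem profile_le (hα : 0 ≤ α) (hδ : 0 ≤ δ) : profile α β δ x ≤ 3 * δ ^ α := by
  refine (wave_le (le_max_left _ _)).trans ?_
  gcongr
  exact max_le hδ (min_le_right _ _)

theorem hasDerivAt_wave (α β : ℝ) (hx : 0 < x) :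
    HasDerivAt (wave α β) (α * x ^ (α - 1) * (2 + Real.sin (x ^ (-β))) -
      β * x ^ (α - β - 1) * Real.cos (x ^ (-β))) x := by
  have h := (Real.hasDerivAt_rpow_const (p := α) (Or.inl hx.ne')).mul
    ((Real.hasDerivAt_rpow_const (p := -β) (Or.inl hx.ne')).sin.const_add 2)
  refine h.congr_deriv ?_
  rw [show α - β - 1 = α + (-β - 1) by ring, Real.rpow_add hx]
  ring

theorem hasDerivAt_profile (α β : ℝ) (hx : x ∈ Ioo 0 δ) :
    HasDerivAt (profile α β δ) (α * x ^ (α - 1) * (2 + Real.sin (x ^ (-β))) -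
      β * x ^ (α - β - 1) * Real.cos (x ^ (-β))) x := by
  refine (hasDerivAt_wave α β hx.1).congr_of_eventuallyEq ?_
  filter_upwards [Icc_mem_nhds hx.1 hx.2] with y hy using profile_of_mem hy

theorem continuousAt_profile (hδ : 0 < δ) (hx : 0 < x) : ContinuousAt (profile α β δ) x := by
  have h : 0 < max 0 (min x δ) := (lt_min hx hδ).trans_le (le_max_right _ _)
  exact (hasDerivAt_wave α β h).continuousAt.comp (f := fun x => max 0 (min x δ)) (by fun_prop)

theorem hasDerivAt_waveBound (hβα : β ≠ α) (hx : 0 < x) :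
    HasDerivAt (waveBound α β) (3 * α * x ^ (α - 1) + β * x ^ (α - β - 1)) x := by
  have h := ((Real.hasDerivAt_rpow_const (p := α) (Or.inl hx.ne')).const_mul 3).add
    ((Real.hasDerivAt_rpow_const (p := α - β) (Or.inl hx.ne')).const_mul (β / (α - β)))
  refine h.congr_deriv ?_
  have : α - β ≠ 0 := sub_ne_zero.2 hβα.symm
  field_simp

theorem monotoneOn_waveBound (hβ : 0 ≤ β) (hβα : β ≤ α) : MonotoneOn (waveBound α β) (Ici 0) := by
  intro x (hx : 0 ≤ x) y _ hxy
  have := sub_nonneg.2 hβα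
  have := hβ.trans hβα
  unfold waveBound
  gcongr

theorem abs_deriv_wave_le (hx : 0 < x) (hα : 0 ≤ α) (hβ : 0 ≤ β) :
    |α * x ^ (α - 1) * (2 + Real.sin (x ^ (-β))) - β * x ^ (α - β - 1) * Real.cos (x ^ (-β))| ≤
      3 * α * x ^ (α - 1) + β * x ^ (α - β - 1) := by
  have hsin : |2 + Real.sin (x ^ (-β))| ≤ 3 :=
    abs_le.2 ⟨by linarith [Real.neg_one_le_sin (x ^ (-β))],
      by linarith [Real.sin_le_one (x ^ (-β))]⟩
  refine (abs_sub _ _).trans ?_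
  rw [abs_mul (α * _), abs_mul (β * _), abs_of_nonneg (by positivity : 0 ≤ α * x ^ (α - 1)),
    abs_of_nonneg (by positivity : 0 ≤ β * x ^ (α - β - 1)), mul_assoc 3, mul_comm 3]
  exact add_le_add (by gcongr) (mul_le_of_le_one_right (by positivity) (Real.abs_cos_le_one _))

theorem abs_wave_sub_le (hβ : 0 < β) (hβα : β < α) (hx : 0 ≤ x) (hxy : x ≤ y) :
    |wave α β y - wave α β x| ≤ waveBound α β y - waveBound α β x := by
  have hα := hβ.trans hβα
  rcases hx.eq_or_lt with rfl | hx
  · have : 0 ≤ β / (α - β) * y ^ (α - β) :=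
      mul_nonneg (div_nonneg hβ.le (by linarith)) (by positivity)
    simp only [wave, waveBound, Real.zero_rpow hα.ne', Real.zero_rpow (sub_pos.2 hβα).ne', zero_mul,
      mul_zero, add_zero, sub_zero]
    rw [← wave, abs_of_nonneg ((Real.rpow_nonneg hxy α).trans (rpow_le_wave hxy))]
    linarith [wave_le (α := α) (β := β) hxy]
  have hpos : ∀ z ∈ Icc x y, 0 < z := fun z hz => hx.trans_le hz.1
  have key := image_norm_le_of_norm_deriv_right_le_deriv_boundary'
    (f := fun z => wave α β z - wave α β x) (B := fun z => waveBound α β z - waveBound α β x)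
    (fun z hz => ((hasDerivAt_wave α β (hpos z hz)).sub_const _).continuousAt.continuousWithinAt)
    (fun z hz => ((hasDerivAt_wave α β
      (hpos z (Ico_subset_Icc_self hz))).sub_const _).hasDerivWithinAt) (by simp)
    (fun z hz =>
      ((hasDerivAt_waveBound hβα.ne (hpos z hz)).sub_const _).continuousAt.continuousWithinAt)
    (fun z hz => ((hasDerivAt_waveBound hβα.ne
      (hpos z (Ico_subset_Icc_self hz))).sub_const _).hasDerivWithinAt) ?_
  · exact key (right_mem_Icc.2 hxy)
  · exact fun z hz => abs_deriv_wave_le (hpos z (Ico_subset_Icc_self hz)) hα.le hβ.le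

theorem boundedVariationOn_profile (hβ : 0 < β) (hβα : β < α) (hδ : 0 ≤ δ) :
    BoundedVariationOn (profile α β δ) univ := by
  set trunc : ℝ → ℝ := fun x => max 0 (min x δ)
  have trunc_mono : Monotone trunc := fun x y h => max_le_max le_rfl (min_le_min h le_rfl)
  have trunc_nonneg : ∀ x, 0 ≤ trunc x := fun x => le_max_left _ _
  have bound_mono : Monotone (waveBound α β ∘ trunc) := fun x y h =>
    monotoneOn_waveBound hβ.le hβα.le (trunc_nonneg x) (trunc_nonneg y) (trunc_mono h)
  have bound_nonneg : ∀ x, 0 ≤ waveBound α β (trunc x) := fun x => by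
    have := trunc_nonneg x
    have := sub_pos.2 hβα
    unfold waveBound
    positivity
  have hbound : BoundedVariationOn (waveBound α β ∘ trunc) univ :=
    (bound_mono.monotoneOn univ).boundedVariationOn (C := waveBound α β δ) fun x _ => by
      rw [Function.comp_apply, abs_of_nonneg (bound_nonneg x)]
      exact monotoneOn_waveBound hβ.le hβα.le (trunc_nonneg x) hδ (max_le hδ (min_le_right _ _))
  refine ne_top_of_le_ne_top hbound (eVariationOn_le_of_edist_le fun x _ y _ => ?_)
  wlog hxy : x ≤ y generalizing x y
  · rw [edist_comm, edist_comm (_ : ℝ) ((waveBound α β ∘ trunc) y)]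
    exact this y trivial x trivial (le_of_not_ge hxy)
  rw [edist_comm, edist_comm (_ : ℝ) ((waveBound α β ∘ trunc) y), edist_dist, edist_dist,
    Real.dist_eq, Real.dist_eq]
  exact ENNReal.ofReal_le_ofReal
    ((abs_wave_sub_le hβ hβα (trunc_nonneg x) (trunc_mono hxy)).trans (le_abs_self _))

end Profile

/-- The points at which the sine in `wave` is alternately `1` and `-1`. -/
noncomputable def crest (β : ℝ) (k : ℕ) : ℝ := (Real.pi / 2 + k * Real.pi) ^ (-β⁻¹)

section Crest

variable {α β : ℝ}

theorem crest_pos (β : ℝ) (k : ℕ) : 0 < crest β k := by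
  have := Real.pi_pos
  unfold crest; positivity

theorem antitone_crest (hβ : 0 ≤ β) : Antitone (crest β) := by
  intro j k hjk
  have := Real.pi_pos
  refine Real.rpow_le_rpow_of_nonpos (by positivity) ?_ (neg_nonpos.2 (inv_nonneg.2 hβ))
  gcongr

theorem crest_rpow_neg (hβ : β ≠ 0) (k : ℕ) : crest β k ^ (-β) = Real.pi / 2 + k * Real.pi := by
  have := Real.pi_pos
  rw [crest, ← Real.rpow_mul (by positivity), neg_mul_neg, inv_mul_cancel₀ hβ, Real.rpow_one]

theorem tendsto_crest (hβ : 0 < β) : Tendsto (crest β) atTop (𝓝 0) :=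
  (tendsto_rpow_neg_atTop (inv_pos.2 hβ)).comp <| tendsto_atTop_add_const_left _ _
    (tendsto_natCast_atTop_atTop.atTop_mul_const Real.pi_pos)

theorem wave_crest (hβ : β ≠ 0) (k : ℕ) :
    wave α β (crest β k) = crest β k ^ α * (2 + (-1) ^ k) := by
  rw [wave, crest_rpow_neg hβ, Real.sin_add_nat_mul_pi, Real.sin_pi_div_two, mul_one]

theorem one_div_le_crest_rpow (hα : 0 < α) (hβ : α / 3 ≤ β) (n : ℕ) :
    1 / (8 * ((n : ℝ) + 1)) ≤ crest β (2 * n) ^ (α / 3) := by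
  have hβ0 : 0 < β := by linarith
  have hpi := Real.pi_gt_three
  have hpi' := Real.pi_lt_four
  have : (0 : ℝ) ≤ n := n.cast_nonneg
  set b : ℝ := Real.pi / 2 + ((2 * n : ℕ) : ℝ) * Real.pi with hb
  have hb1 : 1 ≤ b := by rw [hb]; push_cast; nlinarith
  have hb2 : b ≤ 8 * (n + 1) := by rw [hb]; push_cast; nlinarith
  have he : β⁻¹ * (α / 3) ≤ 1 := by rwa [inv_mul_le_iff₀ hβ0, mul_one]
  calc 1 / (8 * ((n : ℝ) + 1)) ≤ 1 / b := one_div_le_one_div_of_le (by linarith) hb2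
    _ = b ^ (-1 : ℝ) := by rw [Real.rpow_neg_one, one_div]
    _ ≤ b ^ (-β⁻¹ * (α / 3)) := Real.rpow_le_rpow_of_exponent_le hb1 (by linarith)
    _ = crest β (2 * n) ^ (α / 3) := by rw [crest, ← hb, ← Real.rpow_mul (by linarith)]

theorem tendsto_sum_crest_rpow (hα : 0 < α) (hβ : α / 3 ≤ β) (N : ℕ) :
    Tendsto (fun n => ∑ i ∈ Finset.range n, crest β (2 * (N + i)) ^ (α / 3)) atTop atTop := by
  have harmonic : Tendsto (fun n : ℕ => (1 / (8 * (N + 1) : ℝ)) *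
      ∑ i ∈ Finset.range n, 1 / ((i : ℝ) + 1)) atTop atTop :=
    Real.tendsto_sum_range_one_div_nat_succ_atTop.const_mul_atTop (by positivity)
  refine tendsto_atTop_mono (fun n => ?_) harmonic
  rw [Finset.mul_sum]
  refine Finset.sum_le_sum fun i _ => le_trans ?_ (one_div_le_crest_rpow hα hβ (N + i))
  rw [one_div_mul_one_div]
  refine one_div_le_one_div_of_le (by positivity) ?_
  push_cast
  nlinarith [mul_nonneg (N.cast_nonneg (α := ℝ)) (i.cast_nonneg (α := ℝ))]

end Crest

/-! ### States with one shock of unit strength -/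

/-- The state `(ρ₀, u₀)` has `w₁ = 0` and `w₂ = Q` to the left of `p`, `w₁ = 1` to the right of `p`,
and there `w₂` takes the values that 2-waves with profile `Q` acquire by crossing 1-shocks of unit
strength. This describes the approximate solutions at a fixed time. -/
structure IsUnitShock (Q : ℝ → ℝ) (p : ℝ) (ρ₀ u₀ : ℝ → ℝ) : Prop where
  w₁_left : ∀ ⦃x⦄, x < p → w₁ (ρ₀ x) (u₀ x) = 0
  w₂_left : ∀ ⦃x⦄, x < p → w₂ (ρ₀ x) (u₀ x) = Q x
  w₁_right : ∀ ⦃x⦄, p < x → w₁ (ρ₀ x) (u₀ x) = 1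
  w₂_right : ∀ ⦃x⦄, p < x → w₂ (ρ₀ x) (u₀ x) = behind (Q x / 2)

namespace IsUnitShock

variable {Q ρ₀ u₀ : ℝ → ℝ} {p q x : ℝ}

theorem state_left (h : IsUnitShock Q p ρ₀ u₀) (hx : x < p) :
    ρ₀ x = Q x / 2 ∧ u₀ x = Q x / 2 := by
  have h₁ := h.w₁_left hx
  have h₂ := h.w₂_left hx
  unfold w₁ at h₁
  unfold w₂ at h₂
  constructor <;> linarith

theorem state_right (h : IsUnitShock Q p ρ₀ u₀) (hx : p < x) :
    ρ₀ x = Q x / 2 + jump (Q x / 2) ∧ u₀ x = Q x / 2 + jump (Q x / 2) - 1 := by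
  have h₁ := h.w₁_right hx
  have h₂ := h.w₂_right hx
  unfold w₁ at h₁
  unfold w₂ behind at h₂
  constructor <;> linarith

theorem hasDerivAt_w₂ (h : IsUnitShock Q p ρ₀ u₀) (hx : p < x) (hpos : 0 < Q x)
    (hQ : HasDerivAt Q q x) :
    HasDerivAt (fun x => w₂ (ρ₀ x) (u₀ x)) ((1 + jumpSlope (Q x / 2) (jump (Q x / 2))) * q) x := by
  have hcomp : HasDerivAt (fun x => behind (Q x / 2)) _ x :=
    (hasDerivAt_behind (half_pos hpos)).comp (h₂ := behind) x (hQ.div_const 2)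
  refine (hcomp.congr_deriv (by ring)).congr_of_eventuallyEq ?_
  filter_upwards [Ioi_mem_nhds hx] with y hy using h.w₂_right hy

theorem le_abs_deriv_w₂ {κ a₀ : ℝ} (h : IsUnitShock Q p ρ₀ u₀)
    (h₀ : ∀ a ∈ Ioo 0 a₀, κ * a ^ (-(2 / 3) : ℝ) ≤ jumpSlope a (jump a)) (hx : p < x)
    (hQx : Q x / 2 ∈ Ioo 0 a₀) (hQ : HasDerivAt Q q x) :
    κ * (Q x / 2) ^ (-(2 / 3) : ℝ) * |q| ≤ |deriv (fun x => w₂ (ρ₀ x) (u₀ x)) x| := by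
  have hslope := h₀ _ hQx
  have hpos := (isUnitJump_jump hQx.1).jumpSlope_pos
  rw [(h.hasDerivAt_w₂ hx (by linarith [hQx.1]) hQ).deriv, abs_mul,
    abs_of_pos (add_pos one_pos hpos)]
  gcongr
  linarith

theorem totalVariation_lt_top {m : ℝ} (h : IsUnitShock Q p ρ₀ u₀) (hQ : BoundedVariationOn Q univ)
    (hm : 0 < m) (hQm : ∀ x, p < x → m ≤ Q x) : totalVariation ρ₀ u₀ < ⊤ := by
  obtain ⟨C, hC⟩ := exists_lipschitzOnWith_behind (half_pos hm)
  have hhalf : BoundedVariationOn (fun x => Q x / 2) univ := by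
    simpa only [Function.comp_def, smul_eq_mul, inv_mul_eq_div] using
      (lipschitzWith_smul (2⁻¹ : ℝ)).comp_boundedVariationOn hQ
  have hbehind : BoundedVariationOn (fun x => behind (Q x / 2)) (Ioi p) :=
    hC.comp_boundedVariationOn (fun x hx => div_le_div_of_nonneg_right (hQm x hx) zero_le_two)
      (hhalf.mono (subset_univ _))
  refine ENNReal.add_lt_top.2 ⟨lt_top_iff_ne_top.2 ?_, lt_top_iff_ne_top.2 ?_⟩
  · exact boundedVariationOn_univ_of_Iio_of_Ioi (boundedVariationOn_of_forall_eq h.w₁_left)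
      (boundedVariationOn_of_forall_eq h.w₁_right)
  · refine boundedVariationOn_univ_of_Iio_of_Ioi (p := p) ?_ ?_
    · rw [BoundedVariationOn, eVariationOn.congr fun x (hx : x ∈ Iio p) => h.w₂_left hx]
      exact hQ.mono (subset_univ _)
    · rwa [BoundedVariationOn, eVariationOn.congr fun x (hx : x ∈ Ioi p) => h.w₂_right hx]

theorem eVariationOn_le_totalVariation (h : IsUnitShock Q p ρ₀ u₀) :
    eVariationOn (fun x => behind (Q x / 2)) (Ioi p) ≤ totalVariation ρ₀ u₀ :=
  calc eVariationOn (fun x => behind (Q x / 2)) (Ioi p)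
      = eVariationOn (fun x => w₂ (ρ₀ x) (u₀ x)) (Ioi p) :=
        (eVariationOn.congr h.w₂_right).symm
    _ ≤ eVariationOn (fun x => w₂ (ρ₀ x) (u₀ x)) univ := eVariationOn.mono _ (subset_univ _)
    _ ≤ totalVariation ρ₀ u₀ := le_add_self

end IsUnitShock

theorem isInitialDatum_iff_isUnitShock {α β δ ξ : ℝ} {ρ₀ u₀ : ℝ → ℝ} (hα : 0 ≤ α) (hδ : 0 < δ)
    (hδξ : δ ≤ ξ) :
    IsInitialDatum α β δ ξ ρ₀ u₀ ↔ IsUnitShock (profile α β δ) ξ ρ₀ u₀ := by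
  have hconst : ∀ x, ξ < x → profile α β δ x = profile α β δ ξ := fun x hx => by
    rw [profile, profile, min_eq_right hδξ, min_eq_right (hδξ.trans hx.le)]
  constructor
  · rintro ⟨left, ρL, uL, ρR, uR, h₁, h₂, hS, hjump, right⟩
    have h₁' := hS.w₁_eq_one h₁ hjump
    refine ⟨fun x hx => (left x hx).1, fun x hx => (left x hx).2, fun x hx => ?_, fun x hx => ?_⟩
    · rw [(right x hx).1, (right x hx).2, h₁']
    · rw [(right x hx).1, (right x hx).2, hS.w₂_eq_behind h₁ h₁', h₂, hconst x hx]
  · intro h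
    set a := profile α β δ ξ / 2
    refine ⟨fun x hx => ⟨h.w₁_left hx, h.w₂_left hx⟩, a, a, a + jump a, a + jump a - 1, sub_self a,
      add_halves _, isOneShock_behind (half_pos (profile_pos hα hδ (hδ.trans_le hδξ))),
      by simp [w₁], fun x hx => ?_⟩
    rw [(h.state_right hx).1, (h.state_right hx).2, hconst x hx]
    exact ⟨rfl, rfl⟩

/-! ### Approximate solutions -/

section ApproxSolution

variable {P : ℝ → ℝ} {c ξ T t x : ℝ} {ρ u : ℝ → ℝ → ℝ}

theorem continuous_w₁ : Continuous fun z : ℝ × ℝ => w₁ z.1 z.2 := continuous_fst.sub continuous_snd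

theorem continuous_w₂ : Continuous fun z : ℝ × ℝ => w₂ z.1 z.2 := continuous_fst.add continuous_snd

theorem tendsto_prodMk_leftRegion (c ξ : ℝ) (ht : t ∈ Ico 0 T) :
    Tendsto (fun x => (t, x)) (𝓝[<] (ξ - c * t)) (𝓝[leftRegion c ξ T] (t, ξ - c * t)) :=
  tendsto_nhdsWithin_iff.2 ⟨(Continuous.prodMk_right t).continuousAt.mono_left nhdsWithin_le_nhds,
    by filter_upwards [self_mem_nhdsWithin] with x hx using ⟨ht.1, ht.2, hx⟩⟩

theorem tendsto_prodMk_rightRegion (c ξ : ℝ) (ht : t ∈ Ico 0 T) :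
    Tendsto (fun x => (t, x)) (𝓝[>] (ξ - c * t)) (𝓝[rightRegion c ξ T] (t, ξ - c * t)) :=
  tendsto_nhdsWithin_iff.2 ⟨(Continuous.prodMk_right t).continuousAt.mono_left nhdsWithin_le_nhds,
    by filter_upwards [self_mem_nhdsWithin] with x hx using ⟨ht.1, ht.2, hx⟩⟩

namespace IsApproxSolution

theorem w₁_eq_initial (h : IsApproxSolution c ξ T ρ u) (ht : t ∈ Ico 0 T) (hx : x ≠ ξ - c * t) :
    w₁ (ρ t x) (u t x) = w₁ (ρ 0 (x + c * t)) (u 0 (x + c * t)) := by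
  have := h.one_waves 0 t (x + c * t) le_rfl ht.1 ht.2
    (by rwa [mul_zero, sub_zero, Ne, ← eq_sub_iff_add_eq])
  rwa [sub_zero, add_sub_cancel_right] at this

theorem w₂_eq_initial (h : IsApproxSolution c ξ T ρ u) (ht : t ∈ Ico 0 T)
    (hx : x < ξ - c * t ∨ ξ + c * t < x) :
    w₂ (ρ t x) (u t x) = w₂ (ρ 0 (x - c * t)) (u 0 (x - c * t)) := by
  have := h.two_waves 0 t (x - c * t) le_rfl ht.1 ht.2
    (hx.imp (fun hx => by linarith) fun hx => by linarith)
  rwa [sub_zero, sub_add_cancel] at this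

variable (h : IsApproxSolution c ξ T ρ u) (h₀ : IsUnitShock P ξ (ρ 0) (u 0))

include h h₀

theorem w₁_left (ht : t ∈ Ico 0 T) (hx : x < ξ - c * t) : w₁ (ρ t x) (u t x) = 0 :=
  (h.w₁_eq_initial ht hx.ne).trans (h₀.w₁_left (lt_sub_iff_add_lt.1 hx))

theorem w₁_right (ht : t ∈ Ico 0 T) (hx : ξ - c * t < x) : w₁ (ρ t x) (u t x) = 1 :=
  (h.w₁_eq_initial ht hx.ne').trans (h₀.w₁_right (sub_lt_iff_lt_add.1 hx))

theorem w₂_left (hc : 0 ≤ c) (ht : t ∈ Ico 0 T) (hx : x < ξ - c * t) :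
    w₂ (ρ t x) (u t x) = P (x - c * t) :=
  (h.w₂_eq_initial ht (Or.inl hx)).trans
    (h₀.w₂_left (by linarith [mul_nonneg hc ht.1]))

theorem tendsto_w₂_rightRegion (hc : 0 ≤ c) (ht : t ∈ Ico 0 T)
    (hP : ContinuousAt P (ξ - 2 * c * t)) :
    Tendsto (fun z : ℝ × ℝ => w₂ (ρ z.1 z.2) (u z.1 z.2)) (𝓝[rightRegion c ξ T] (t, ξ - c * t))
      (𝓝 (behind (P (ξ - 2 * c * t) / 2))) := by
  obtain ⟨ρL, uL, ρR, uR, hL, hR, hS⟩ := h.shock t ht.1 ht.2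
  have w₁_L : w₁ ρL uL = 0 := by
    refine tendsto_nhds_unique
      (((continuous_w₁.tendsto _).comp hL).comp (tendsto_prodMk_leftRegion c ξ ht))
      (tendsto_const_nhds.congr' ?_)
    filter_upwards [self_mem_nhdsWithin] with x hx using (h.w₁_left h₀ ht hx).symm
  have w₂_L : w₂ ρL uL = P (ξ - 2 * c * t) := by
    have shift : Tendsto (fun x => x - c * t) (𝓝[<] (ξ - c * t)) (𝓝 (ξ - 2 * c * t)) :=
      ((continuous_sub_right (c * t)).tendsto' _ _ (by ring)).mono_left nhdsWithin_le_nhds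
    refine tendsto_nhds_unique
      (((continuous_w₂.tendsto _).comp hL).comp (tendsto_prodMk_leftRegion c ξ ht))
      ((hP.tendsto.comp shift).congr' ?_)
    filter_upwards [self_mem_nhdsWithin] with x hx using (h.w₂_left h₀ hc ht hx).symm
  have w₁_R : w₁ ρR uR = 1 := by
    refine tendsto_nhds_unique
      (((continuous_w₁.tendsto _).comp hR).comp (tendsto_prodMk_rightRegion c ξ ht))
      (tendsto_const_nhds.congr' ?_)
    filter_upwards [self_mem_nhdsWithin] with x hx using (h.w₁_right h₀ ht hx).symm
  rw [← w₂_L, ← hS.w₂_eq_behind w₁_L w₁_R]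
  exact (continuous_w₂.tendsto (ρR, uR)).comp hR

theorem w₂_right (hc : 0 < c) (ht : t ∈ Ico 0 T)
    (hP : ∀ s ∈ Ico 0 T, ContinuousAt P (ξ - 2 * c * s)) (hx : ξ - c * t < x) :
    w₂ (ρ t x) (u t x) = behind (P (x - c * t) / 2) := by
  rcases lt_or_ge (ξ + c * t) x with hy | hy
  · exact (h.w₂_eq_initial ht (Or.inr hy)).trans (h₀.w₂_right (by linarith))
  obtain ⟨y, rfl⟩ : ∃ y, x = y + c * t := ⟨x - c * t, by ring⟩
  -- The 2-wave through the point left the shock at the time `s`.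
  obtain ⟨s, rfl⟩ : ∃ s, y = ξ - 2 * c * s := ⟨(ξ - y) / (2 * c), by field_simp; ring⟩
  have hs : 0 ≤ s := nonneg_of_mul_nonneg_right (by linarith : 0 ≤ 2 * c * s) (by linarith)
  have hst : s < t := lt_of_mul_lt_mul_left (by linarith : 2 * c * s < 2 * c * t) (by linarith)
  have hsT : s ∈ Ico 0 T := ⟨hs, hst.trans ht.2⟩
  have ray : Tendsto (fun σ => (σ, ξ - 2 * c * s + c * σ)) (𝓝[>] s)
      (𝓝[rightRegion c ξ T] (s, ξ - c * s)) := by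
    have hcont : Continuous fun σ : ℝ => (σ, ξ - 2 * c * s + c * σ) := by fun_prop
    refine tendsto_nhdsWithin_iff.2 ⟨(hcont.tendsto' _ _ (by ring_nf)).mono_left
      nhdsWithin_le_nhds, ?_⟩
    filter_upwards [Ioo_mem_nhdsGT hst] with σ hσ
    have := mul_lt_mul_of_pos_left hσ.1 hc
    exact ⟨hs.trans hσ.1.le, hσ.2.trans ht.2, by simp only; linarith⟩
  rw [add_sub_cancel_right]
  refine tendsto_nhds_unique (tendsto_const_nhds.congr' ?_)
    ((h.tendsto_w₂_rightRegion h₀ hc.le hsT (hP s hsT)).comp ray)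
  filter_upwards [Ioo_mem_nhdsGT hst] with σ hσ
  have := mul_lt_mul_of_pos_left hσ.1 hc
  have key := h.two_waves σ t (ξ - 2 * c * s + c * σ) (hs.trans hσ.1.le) hσ.2.le ht.2
    (Or.inr (by linarith))
  rwa [add_assoc, ← mul_add, add_sub_cancel] at key

theorem isUnitShock (hc : 0 < c) (hP : ∀ s ∈ Ico 0 T, ContinuousAt P (ξ - 2 * c * s))
    (ht : t ∈ Ico 0 T) :
    IsUnitShock (fun x => P (x - c * t)) (ξ - c * t) (ρ t) (u t) :=
  ⟨fun _ => h.w₁_left h₀ ht, fun _ => h.w₂_left h₀ hc.le ht, fun _ => h.w₁_right h₀ ht,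
    fun _ => h.w₂_right h₀ hc ht hP⟩

end IsApproxSolution

end ApproxSolution

/-- The state, as a pair of a density and a velocity, with a 1-shock of unit strength at `p` and
profile `Q` of `w₂`. -/
noncomputable def unitShock (Q : ℝ → ℝ) (p x : ℝ) : ℝ × ℝ :=
  if x < p then (Q x / 2, Q x / 2) else (Q x / 2 + jump (Q x / 2), Q x / 2 + jump (Q x / 2) - 1)

theorem isUnitShock_unitShock (Q : ℝ → ℝ) (p : ℝ) :
    IsUnitShock Q p (fun x => (unitShock Q p x).1) fun x => (unitShock Q p x).2 := by
  constructor <;> intro x hx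
  · simp only [unitShock, if_pos hx, w₁, sub_self]
  · simp only [unitShock, if_pos hx, w₂, add_halves]
  · simp only [unitShock, if_neg hx.not_gt, w₁, sub_sub_cancel]
  · simp only [unitShock, if_neg hx.not_gt, w₂, behind]
    ring

theorem unitShock_density_nonneg {Q : ℝ → ℝ} {p : ℝ} (hQ : ∀ x, 0 ≤ Q x)
    (hpos : ∀ x, p ≤ x → 0 < Q x) (x : ℝ) : 0 ≤ (unitShock Q p x).1 := by
  unfold unitShock
  split_ifs with hx
  · exact div_nonneg (hQ x) zero_le_two
  · have h := half_pos (hpos x (not_lt.1 hx))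
    exact (add_pos h (isUnitJump_jump h).pos).le

section Evolution

variable {P : ℝ → ℝ} {c ξ T : ℝ} {ρ u : ℝ → ℝ → ℝ}

theorem isApproxSolution_of_isUnitShock (hc : 0 ≤ c) (hρ : ∀ t x, 0 ≤ t → t < T → 0 ≤ ρ t x)
    (h : ∀ t, IsUnitShock (fun x => P (x - c * t)) (ξ - c * t) (ρ t) (u t))
    (hpos : ∀ t ∈ Ico 0 T, 0 < P (ξ - 2 * c * t))
    (hP : ∀ t ∈ Ico 0 T, ContinuousAt P (ξ - 2 * c * t)) :
    IsApproxSolution c ξ T ρ u where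
  density_nonneg := hρ
  one_waves s t y _ _ _ hy := by
    rcases hy.lt_or_gt with hy | hy
    · rw [(h s).w₁_left hy, (h t).w₁_left (by linarith)]
    · rw [(h s).w₁_right hy, (h t).w₁_right (by linarith)]
  two_waves s t y _ hst _ hy := by
    have hshift : y + c * (t - s) - c * t = y - c * s := by ring
    have := mul_nonneg hc (sub_nonneg.2 hst)
    rcases hy with hy | hy
    · rw [(h t).w₂_left hy, (h s).w₂_left (by linarith), hshift]
    · rw [(h t).w₂_right (by linarith), (h s).w₂_right hy, hshift]
  shock t ht htT := by
    have hpos := half_pos (hpos t ⟨ht, htT⟩)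
    have foot : Tendsto (fun z : ℝ × ℝ => z.2 - c * z.1) (𝓝 (t, ξ - c * t))
        (𝓝 (ξ - 2 * c * t)) :=
      (by fun_prop : Continuous fun z : ℝ × ℝ => z.2 - c * z.1).tendsto' _ _ (by ring)
    have ahead := ((hP t ⟨ht, htT⟩).tendsto.comp foot).div_const 2
    have jump := ahead.add ((continuousAt_jump hpos).tendsto.comp ahead)
    refine ⟨_, _, _, _, ?_, ?_, isOneShock_behind hpos⟩
    · refine ((ahead.prodMk_nhds ahead).mono_left nhdsWithin_le_nhds).congr' ?_
      filter_upwards [self_mem_nhdsWithin] with z hz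
      exact Prod.ext ((h z.1).state_left hz.2.2).1.symm ((h z.1).state_left hz.2.2).2.symm
    · refine ((jump.prodMk_nhds (jump.sub_const 1)).mono_left nhdsWithin_le_nhds).congr' ?_
      filter_upwards [self_mem_nhdsWithin] with z hz
      exact Prod.ext ((h z.1).state_right hz.2.2).1.symm ((h z.1).state_right hz.2.2).2.symm

theorem sub_pos_of_mem_Ico {t : ℝ} (hc : 0 < c) (ht : t ∈ Ico 0 (ξ / (2 * c))) :
    0 < ξ - 2 * c * t :=
  sub_pos.2 ((lt_div_iff₀' (by positivity)).1 ht.2)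

theorem exists_isApproxSolution {α β δ : ℝ} (hα : 0 ≤ α) (hδ : 0 < δ) (hδξ : δ ≤ ξ) (hc : 0 < c) :
    ∃ ρ u : ℝ → ℝ → ℝ, IsInitialDatum α β δ ξ (ρ 0) (u 0) ∧
      IsApproxSolution c ξ (ξ / (2 * c)) ρ u := by
  set state := fun t => unitShock (fun x => profile α β δ (x - c * t)) (ξ - c * t)
  refine ⟨fun t x => (state t x).1, fun t x => (state t x).2, ?_,
    isApproxSolution_of_isUnitShock (P := profile α β δ) hc.le (fun t x ht htT => ?_)
      (fun t => isUnitShock_unitShock _ _)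
      (fun t ht => profile_pos hα hδ (sub_pos_of_mem_Ico hc ht))
      (fun t ht => continuousAt_profile hδ (sub_pos_of_mem_Ico hc ht))⟩
  · rw [isInitialDatum_iff_isUnitShock hα hδ hδξ]
    simpa only [state, mul_zero, sub_zero] using isUnitShock_unitShock (profile α β δ) ξ
  · have := sub_pos_of_mem_Ico hc ⟨ht, htT⟩
    exact unitShock_density_nonneg (fun _ => profile_nonneg _ _ _ _)
      (fun y hy => profile_pos hα hδ (by linarith)) x

variable {t : ℝ}

theorem IsUnitShock.le_abs_w₂_sub {κ a₀ : ℝ}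
    (h : IsUnitShock (fun x => P (x - c * t)) (ξ - c * t) (ρ t) (u t))
    (h₀ : IsUnitShock P ξ (ρ 0) (u 0))
    (hκ : ∀ a ∈ Ioo 0 a₀, κ * a ^ (-(2 / 3) : ℝ) ≤ jumpSlope a (jump a))
    (hP : ∀ x ∈ Ioo (ξ - 2 * c * t) ξ, P x / 2 ∈ Ioo 0 a₀) {y z : ℝ}
    (hy : y ∈ Ioo (ξ - 2 * c * t) ξ) (hz : z ∈ Ioo (ξ - 2 * c * t) ξ) :
    κ * max (ρ 0 y) (ρ 0 z) ^ (-(2 / 3) : ℝ) * |w₂ (ρ 0 y) (u 0 y) - w₂ (ρ 0 z) (u 0 z)| ≤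
      |w₂ (ρ t (y + c * t)) (u t (y + c * t)) - w₂ (ρ t (z + c * t)) (u t (z + c * t))| := by
  rw [h.w₂_right (by linarith [hy.1]), h.w₂_right (by linarith [hz.1]), add_sub_cancel_right,
    add_sub_cancel_right, h₀.w₂_left hy.2, h₀.w₂_left hz.2, (h₀.state_left hy.2).1,
    (h₀.state_left hz.2).1]
  simpa only [mul_div_cancel₀ _ (two_ne_zero' ℝ)] using le_abs_behind_sub hκ (hP y hy) (hP z hz)

theorem IsUnitShock.le_abs_deriv_w₂_of_shift {κ a₀ q y : ℝ}
    (h : IsUnitShock (fun x => P (x - c * t)) (ξ - c * t) (ρ t) (u t))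
    (h₀ : IsUnitShock P ξ (ρ 0) (u 0))
    (hκ : ∀ a ∈ Ioo 0 a₀, κ * a ^ (-(2 / 3) : ℝ) ≤ jumpSlope a (jump a))
    (hy : y ∈ Ioo (ξ - 2 * c * t) ξ) (hPy : P y / 2 ∈ Ioo 0 a₀) (hP : HasDerivAt P q y) :
    DifferentiableAt ℝ (fun x => w₂ (ρ t x) (u t x)) (y + c * t) ∧
      κ * ρ 0 y ^ (-(2 / 3) : ℝ) * |q| ≤ |deriv (fun x => w₂ (ρ t x) (u t x)) (y + c * t)| := by
  have hx : ξ - c * t < y + c * t := by linarith [hy.1]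
  have hyt : y + c * t - c * t = y := add_sub_cancel_right y (c * t)
  have hQ : HasDerivAt (fun x => P (x - c * t)) q (y + c * t) :=
    HasDerivAt.comp_sub_const _ _ (by rwa [hyt])
  have hQx : P (y + c * t - c * t) / 2 ∈ Ioo 0 a₀ := by rwa [hyt]
  refine ⟨(h.hasDerivAt_w₂ hx (by linarith [hQx.1]) hQ).differentiableAt, ?_⟩
  rw [(h₀.state_left hy.2).1]
  simpa only [hyt] using h.le_abs_deriv_w₂ hκ hx hQx hQ

theorem IsUnitShock.totalVariation_lt_top_of_profile {α β δ : ℝ}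
    (h : IsUnitShock (fun x => profile α β δ (x - c * t)) (ξ - c * t) (ρ t) (u t)) (hβ : 0 < β)
    (hβα : β < α) (hδ : 0 < δ) (ht : 0 < ξ - 2 * c * t) : totalVariation (ρ t) (u t) < ⊤ := by
  have hm : 0 < min (ξ - 2 * c * t) δ := lt_min ht hδ
  refine h.totalVariation_lt_top (m := min (ξ - 2 * c * t) δ ^ α) ?_ (by positivity) fun x hx =>
    rpow_le_profile (hβ.trans hβα).le hm.le (min_le_right _ _)
      ((min_le_left _ _).trans (by linarith))
  exact ne_top_of_le_ne_top (boundedVariationOn_profile hβ hβα hδ.le)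
    (eVariationOn.comp_le_of_monotoneOn _ (fun x => x - c * t)
      (fun x _ y _ hxy => sub_le_sub_right hxy _) (mapsTo_univ _ _))

theorem IsUnitShock.eVariationOn_le_totalVariation_of_shift
    (h : IsUnitShock (fun x => P (x - c * t)) (ξ - c * t) (ρ t) (u t)) :
    eVariationOn (fun x => behind (P x / 2)) (Ioi (ξ - 2 * c * t)) ≤
      totalVariation (ρ t) (u t) := by
  refine le_trans ?_ h.eVariationOn_le_totalVariation
  have shift := eVariationOn.comp_le_of_monotoneOn (fun x => behind (P (x - c * t) / 2))
    (t := Ioi (ξ - 2 * c * t)) (s := Ioi (ξ - c * t)) (fun x => x + c * t)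
    (fun x _ y _ hxy => add_le_add_left hxy _) fun x (hx : _ < x) => by
      rw [mem_Ioi]; linarith
  simpa only [Function.comp_def, add_sub_cancel_right] using shift

theorem tendsto_totalVariation (hc : 0 < c) (hξ : 0 < ξ)
    (h : ∀ t ∈ Ico 0 (ξ / (2 * c)),
      IsUnitShock (fun x => P (x - c * t)) (ξ - c * t) (ρ t) (u t))
    (hP : eVariationOn (fun x => behind (P x / 2)) (Ioi 0) = ⊤) :
    Tendsto (fun t => totalVariation (ρ t) (u t)) (𝓝[<] (ξ / (2 * c))) (𝓝 ⊤) := by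
  have before : ∀ᶠ t in 𝓝[<] (ξ / (2 * c)), t ∈ Ico 0 (ξ / (2 * c)) :=
    mem_of_superset (Ioo_mem_nhdsLT (by positivity)) Ioo_subset_Ico_self
  have foot : Tendsto (fun t => ξ - 2 * c * t) (𝓝[<] (ξ / (2 * c))) (𝓝[>] 0) :=
    tendsto_nhdsWithin_iff.2
      ⟨((by fun_prop : Continuous fun t => ξ - 2 * c * t).tendsto' _ _
        (by field_simp; ring)).mono_left nhdsWithin_le_nhds,
        before.mono fun t ht => sub_pos_of_mem_Ico hc ht⟩
  refine tendsto_nhds_top_mono (hP ▸ (tendsto_eVariationOn_Ioi _ 0).comp foot) ?_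
  filter_upwards [before] with t ht using (h t ht).eVariationOn_le_totalVariation_of_shift

end Evolution

/-! ### Blow up -/

section BlowUp

variable {α β δ : ℝ}

theorem exists_le_abs_behind_wave_crest_sub (hα : 0 < α) (hβ : 0 < β) :
    ∃ C > 0, ∀ᶠ k in atTop, C * crest β (2 * k) ^ (α / 3) ≤
      |behind (wave α β (crest β (2 * k + 1)) / 2) - behind (wave α β (crest β (2 * k)) / 2)| := by
  have h3 : (0 : ℝ) < 3 ^ (-(2 / 3) : ℝ) := by positivity
  obtain ⟨a₀, ha₀, hslope⟩ := exists_le_jumpSlope (half_lt_self h3)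
  refine ⟨3 ^ (-(2 / 3) : ℝ) / 2 * (3 / 2) ^ (-(2 / 3) : ℝ) * 2, by positivity, ?_⟩
  have small : Tendsto (fun k => 3 / 2 * crest β (2 * k) ^ α) atTop (𝓝 0) := by
    have := (((tendsto_crest hβ).comp (tendsto_id.const_mul_atTop' two_pos)).rpow_const
      (Or.inr hα.le)).const_mul (3 / 2)
    rwa [Real.zero_rpow hα.ne', mul_zero] at this
  filter_upwards [small.eventually_lt_const ha₀] with k hk
  have hx := crest_pos β (2 * k)
  have hy := Real.rpow_pos_of_pos (crest_pos β (2 * k + 1)) α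
  have hyx : crest β (2 * k + 1) ^ α ≤ crest β (2 * k) ^ α :=
    Real.rpow_le_rpow (crest_pos _ _).le (antitone_crest hβ.le (Nat.le_succ _)) hα.le
  have hwx : wave α β (crest β (2 * k)) / 2 = 3 / 2 * crest β (2 * k) ^ α := by
    rw [wave_crest hβ.ne', (even_two_mul k).neg_one_pow]; ring
  have hwy : wave α β (crest β (2 * k + 1)) / 2 = crest β (2 * k + 1) ^ α / 2 := by
    rw [wave_crest hβ.ne', (odd_two_mul_add_one k).neg_one_pow]; ring
  rw [hwx, hwy]
  generalize crest β (2 * k) = x at *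
  generalize crest β (2 * k + 1) ^ α = r at *
  have hxα := Real.rpow_pos_of_pos hx α
  refine le_trans ?_ (le_abs_behind_sub hslope ⟨by linarith, by linarith⟩ ⟨by linarith, hk⟩)
  rw [max_eq_right (by linarith), abs_sub_comm, abs_of_pos (by linarith),
    Real.mul_rpow (by norm_num) hxα.le, ← Real.rpow_mul hx.le]
  calc 3 ^ (-(2 / 3) : ℝ) / 2 * (3 / 2) ^ (-(2 / 3) : ℝ) * 2 * x ^ (α / 3)
      = 3 ^ (-(2 / 3) : ℝ) / 2 * ((3 / 2) ^ (-(2 / 3) : ℝ) * x ^ (α * -(2 / 3))) * (2 * x ^ α) := by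
        rw [show α / 3 = α * -(2 / 3) + α by ring, Real.rpow_add hx]
        ring
    _ ≤ _ := by gcongr; linarith

theorem eVariationOn_behind_profile_eq_top (hα : 0 < α) (hβ : α / 3 ≤ β) (hδ : 0 < δ) :
    eVariationOn (fun x => behind (profile α β δ x / 2)) (Ioi 0) = ⊤ := by
  have hβ0 : 0 < β := by linarith
  obtain ⟨C, hC, hbehind⟩ := exists_le_abs_behind_wave_crest_sub hα hβ0
  obtain ⟨N, hN⟩ := eventually_atTop.1
    (hbehind.and ((tendsto_crest hβ0).eventually_lt_const hδ))
  have hprofile : ∀ k, profile α β δ (crest β (2 * N + k)) = wave α β (crest β (2 * N + k)) :=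
    fun k => profile_of_mem ⟨(crest_pos _ _).le, (hN _ (by omega)).2.le⟩
  have diverges := ENNReal.tendsto_ofReal_atTop.comp
    ((tendsto_sum_crest_rpow hα hβ N).const_mul_atTop hC)
  refine top_le_iff.1 (le_of_tendsto' diverges fun n => ?_)
  refine le_trans ?_ (sum_edist_even_odd_le_eVariationOn _ (u := fun k => crest β (2 * N + k))
    (fun j k hjk => antitone_crest hβ0.le (by omega)) (fun k => crest_pos _ _) n)
  rw [Function.comp_apply, Finset.mul_sum, ENNReal.ofReal_sum_of_nonneg fun i _ =>
    mul_nonneg hC.le (Real.rpow_nonneg (crest_pos _ _).le _)]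
  refine Finset.sum_le_sum fun i _ => ?_
  rw [edist_dist, Real.dist_eq, hprofile, hprofile, ← add_assoc, ← mul_add]
  exact ENNReal.ofReal_le_ofReal (hN (N + i) (by omega)).1

theorem half_profile_mem_Ioo {a₀ x : ℝ} (hα : 0 < α) (ha₀ : 0 ≤ a₀) (hδ : 0 < δ)
    (hδa : δ < (a₀ / 3) ^ α⁻¹) (hx : 0 < x) : profile α β δ x / 2 ∈ Ioo 0 a₀ := by
  have hlt : δ ^ α < a₀ / 3 := (Real.lt_rpow_inv_iff_of_pos hδ.le (by positivity) hα).1 hδa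
  have hle := profile_le (β := β) (x := x) hα.le hδ.le
  have hδα : 0 < δ ^ α := by positivity
  exact ⟨half_pos (profile_pos hα.le hδ hx), by linarith⟩

end BlowUp

end PSystem

theorem mainTheorem2_general (α β κ : ℝ) (hβ : α / 3 ≤ β) (hβα : β < α)
    (hκ : κ < (3 : ℝ) ^ (-(2 / 3) : ℝ)) :
    ∃ δ₀ : ℝ, 0 < δ₀ ∧ ∀ δ c ξ : ℝ, 0 < δ → δ < δ₀ → 0 < c → δ ≤ ξ →
      (∃ ρ u : ℝ → ℝ → ℝ, PSystem.IsInitialDatum α β δ ξ (ρ 0) (u 0) ∧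
        PSystem.IsApproxSolution c ξ (ξ / (2 * c)) ρ u) ∧
      ∀ ρ u : ℝ → ℝ → ℝ, PSystem.IsInitialDatum α β δ ξ (ρ 0) (u 0) →
        PSystem.IsApproxSolution c ξ (ξ / (2 * c)) ρ u →
        (∀ t x, 0 ≤ t → t < ξ / (2 * c) →
          (x < ξ - c * t → PSystem.w₁ (ρ t x) (u t x) = 0) ∧
          (ξ - c * t < x → PSystem.w₁ (ρ t x) (u t x) = 1)) ∧
        (∀ t y z, 0 ≤ t → t < ξ / (2 * c) →
          y ∈ Ioo (ξ - 2 * c * t) ξ → z ∈ Ioo (ξ - 2 * c * t) ξ →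
          κ * (max (ρ 0 y) (ρ 0 z)) ^ (-(2 / 3) : ℝ) *
              |PSystem.w₂ (ρ 0 y) (u 0 y) - PSystem.w₂ (ρ 0 z) (u 0 z)| ≤
            |PSystem.w₂ (ρ t (y + c * t)) (u t (y + c * t)) -
              PSystem.w₂ (ρ t (z + c * t)) (u t (z + c * t))|) ∧
        (∀ t y, 0 ≤ t → t < ξ / (2 * c) → y ∈ Ioo (ξ - 2 * c * t) δ →
          DifferentiableAt ℝ (fun x => PSystem.w₂ (ρ t x) (u t x)) (y + c * t) ∧
          κ * (ρ 0 y) ^ (-(2 / 3) : ℝ) *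
              |α * y ^ (α - 1) * (2 + Real.sin (y ^ (-β))) -
                β * y ^ (α - β - 1) * Real.cos (y ^ (-β))| ≤
            |deriv (fun x => PSystem.w₂ (ρ t x) (u t x)) (y + c * t)|) ∧
        (∀ t, 0 ≤ t → t < ξ / (2 * c) → PSystem.totalVariation (ρ t) (u t) < ⊤) ∧
        Tendsto (fun t => PSystem.totalVariation (ρ t) (u t)) (𝓝[<] (ξ / (2 * c))) (𝓝 ⊤) := by
  have hα : 0 < α := by linarith
  have hβ0 : 0 < β := by linarith
  obtain ⟨a₀, ha₀, hslope⟩ := PSystem.exists_le_jumpSlope hκ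
  refine ⟨(a₀ / 3) ^ α⁻¹, by positivity, fun δ c ξ hδ hδa hc hδξ =>
    ⟨PSystem.exists_isApproxSolution hα.le hδ hδξ hc, fun ρ u initial h => ?_⟩⟩
  have h₀ := (PSystem.isInitialDatum_iff_isUnitShock hα.le hδ hδξ).1 initial
  have foot_pos := fun t => PSystem.sub_pos_of_mem_Ico (ξ := ξ) (t := t) hc
  have state : ∀ t ∈ Ico 0 (ξ / (2 * c)), PSystem.IsUnitShock
      (fun x => PSystem.profile α β δ (x - c * t)) (ξ - c * t) (ρ t) (u t) := fun t ht =>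
    h.isUnitShock h₀ hc (fun s hs => PSystem.continuousAt_profile hδ (foot_pos s hs)) ht
  have small : ∀ x, 0 < x → PSystem.profile α β δ x / 2 ∈ Ioo 0 a₀ := fun x =>
    PSystem.half_profile_mem_Ioo hα ha₀.le hδ hδa
  refine ⟨fun t x ht htT => ⟨fun hx => (state t ⟨ht, htT⟩).w₁_left hx,
    fun hx => (state t ⟨ht, htT⟩).w₁_right hx⟩, fun t y z ht htT hy hz => ?_,
    fun t y ht htT hy => ?_, fun t ht htT => ?_, ?_⟩
  · exact (state t ⟨ht, htT⟩).le_abs_w₂_sub h₀ hslope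
      (fun x hx => small x ((foot_pos t ⟨ht, htT⟩).trans hx.1)) hy hz
  · have hy0 := (foot_pos t ⟨ht, htT⟩).trans hy.1
    exact (state t ⟨ht, htT⟩).le_abs_deriv_w₂_of_shift h₀ hslope ⟨hy.1, hy.2.trans_le hδξ⟩
      (small y hy0) (PSystem.hasDerivAt_profile α β ⟨hy0, hy.2⟩)
  · exact (state t ⟨ht, htT⟩).totalVariation_lt_top_of_profile hβ0 hβα hδ (foot_pos t ⟨ht, htT⟩)
  · exact PSystem.tendsto_totalVariation hc (hδ.trans_le hδξ) state
      (PSystem.eVariationOn_behind_profile_eq_top hα hβ hδ)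

theorem mainTheorem2 (α β κ : ℝ) (hα : 0 < α / 3) (hβ : α / 3 < β) (hβα : β < α) (hα1 : α < 1)
    (hκ : κ < (3 : ℝ) ^ (-(2 / 3) : ℝ)) :
    ∃ δ₀ : ℝ, 0 < δ₀ ∧ ∀ δ c ξ : ℝ, 0 < δ → δ < δ₀ → 0 < c → δ ≤ ξ →
      (∃ ρ u : ℝ → ℝ → ℝ, PSystem.IsInitialDatum α β δ ξ (ρ 0) (u 0) ∧
        PSystem.IsApproxSolution c ξ (ξ / (2 * c)) ρ u) ∧
      ∀ ρ u : ℝ → ℝ → ℝ, PSystem.IsInitialDatum α β δ ξ (ρ 0) (u 0) →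
        PSystem.IsApproxSolution c ξ (ξ / (2 * c)) ρ u →
        -- the 1-shock keeps unit strength
        (∀ t x, 0 ≤ t → t < ξ / (2 * c) →
          (x < ξ - c * t → PSystem.w₁ (ρ t x) (u t x) = 0) ∧
          (ξ - c * t < x → PSystem.w₁ (ρ t x) (u t x) = 1)) ∧
        -- amplification of the strength of the 2-wave between two points
        (∀ t y z, 0 ≤ t → t < ξ / (2 * c) →
          y ∈ Ioo (ξ - 2 * c * t) ξ → z ∈ Ioo (ξ - 2 * c * t) ξ →
          κ * (max (ρ 0 y) (ρ 0 z)) ^ (-(2 / 3) : ℝ) *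
              |PSystem.w₂ (ρ 0 y) (u 0 y) - PSystem.w₂ (ρ 0 z) (u 0 z)| ≤
            |PSystem.w₂ (ρ t (y + c * t)) (u t (y + c * t)) -
              PSystem.w₂ (ρ t (z + c * t)) (u t (z + c * t))|) ∧
        -- amplification of the gradient
        (∀ t y, 0 ≤ t → t < ξ / (2 * c) → y ∈ Ioo (ξ - 2 * c * t) δ →
          DifferentiableAt ℝ (fun x => PSystem.w₂ (ρ t x) (u t x)) (y + c * t) ∧
          κ * (ρ 0 y) ^ (-(2 / 3) : ℝ) *
              |α * y ^ (α - 1) * (2 + Real.sin (y ^ (-β))) -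
                β * y ^ (α - β - 1) * Real.cos (y ^ (-β))| ≤
            |deriv (fun x => PSystem.w₂ (ρ t x) (u t x)) (y + c * t)|) ∧
        -- finite total variation at the initial time and before the final time, then blow up
        (∀ t, 0 ≤ t → t < ξ / (2 * c) → PSystem.totalVariation (ρ t) (u t) < ⊤) ∧
        Tendsto (fun t => PSystem.totalVariation (ρ t) (u t)) (𝓝[<] (ξ / (2 * c))) (𝓝 ⊤) :=
  mainTheorem2_general α β κ hβ.le hβα hκ
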